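/- **Setting.** Let $-\infty\le a<c\le\infty$ and $J=(a,c)\subseteq\mathbb R$. Let $V\subseteq\mathbb R^n$ be an open coordinate domain with an affine connection whose Christoffel symbols $\Gamma^i_{jl}$ are $C^\infty$ on $V$, and let $x:J\to V$ be a $C^\infty$ curve. Along $x$ define $P^{i\langle k\rangle}_j$, $Q^{i\langle k\rangle}_j$ ($k\ge 0$) by $P^{i\langle 0\rangle}_j=Q^{i\langle 0\rangle}_j=\delta^i_j$, $P^{i\langle 1\rangle}_j=-Q^{i\langle 1\rangle}_j=\Gamma^i_{jl}\,\frac{dx^l}{ds}$ and $$P^{i\langle k+1\rangle}_j=\frac{d}{ds}P^{i\langle k\rangle}_j+P^{l\langle k\rangle}_jP^{i\langle 1\rangle}_l,\qquad Q^{i\langle k+1\rangle}_j=\frac{d}{ds}Q^{i\langle k\rangle}_j+Q^{i\langle k\rangle}_lQ^{l\langle 1\rangle}_j .$$ For real $\gamma$ let $D^\gamma=d^\gamma/ds^\gamma$ be the Riemann–Liouville fractional derivative with lower terminal $a$: $D^\gamma=\frac{d^N}{ds^N}I^{N-\gamma}$, where $N$ is the least natural number with $N\ge\gamma$, $I^0f=f$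 and $I^\mu f(s)=\frac1{\Gamma(\mu)}\int_a^s(s-t)^{\mu-1}f(t)\,dt$ for $\mu>0$. We say that $D^\gamma f$ is defined on $J$ if the integral $I^{N-\gamma}f$ converges absolutely at each point of $J$ and is $N$ times differentiable on $J$. Write $(\alpha)_k=\alpha(\alpha-1)\cdots(\alpha-k+1)$, $(\alpha)_0=1$. For multi-indices $m\in\mathbb N^{p+q}$ write $m=(m_1,\dots,m_p,l_1,\dots,l_q)$, $|m|$ for the sum of the entries and $m!$ for the product of their factorials, and put $$F(m)^{j,v}_{u,i}=P^{j_1\langle m_1\rangle}_{u_1}\cdots P^{j_p\langle m_p\rangle}_{u_p}Q^{v_1\langle l_1\rangle}_{i_1}\cdots Q^{v_q\langle l_q\rangle}_{i_q}.$$ For a tensor field $A$ of type $(p,q)$ along $x$ (given by its components $A^{u_1\cdots u_p}_{v_1\cdots v_q}:J\to\mathbb R$) and $\alpha\in\mathbb R$ the fractional covariant derivative is $$\nabla^\alpha A^{j}_{i}=\sum_{k=0}^\infty G_k[\alpha,A]^j_i,\qquad G_k[\alpha,A]^j_i=\sum_{|m|=k}\sum_{u,v}F(m)^{j,v}_{u,i}\;D^{\alpha-k}A^{u}_{v}\;\frac{(\alpha)_k}{m!}.$$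 **Assumptions.** Let $\alpha,\beta\in\mathbb R$ and let $A$ be such that 1. (semigroup rule) for all components of $A$ and all $k,l\ge0$ with $(\alpha)_k\ne0\ne(\beta)_l$, the derivatives $D^{\alpha-k}A^w_z$, $D^{\beta-l}(D^{\alpha-k}A^w_z)$ and $D^{\alpha+\beta-k-l}A^w_z$ are defined on $J$ and the last two are equal there; 2. (generalized Leibniz rule) for all $u,v,w,z$, all $m\in\mathbb N^{p+q}$ and $l\ge0$ with $(\alpha)_{|m|}\ne0\ne(\beta)_l$, the derivative $D^{\beta-l}$ of the product of $h=D^{\alpha-|m|}A^w_z$ and the $p+q$ factors $f_1,\dots,f_{p+q}$ of $F(m)^{u,z}_{w,v}$ is defined on $J$, and at each point of $J$ $$D^{\beta-l}(f_1\cdots f_{p+q}h)=\sum_{r\in\mathbb N^{p+q}}f_1^{(r_1)}\cdots f_{p+q}^{(r_{p+q})}\,D^{\beta-l-|r|}h\;\frac{(\beta-l)_{|r|}}{r!}$$ with absolute convergence; 3. (convergence of the series for $\nabla^\alpha A$) for all $u,v$ the series $\sum_kG_k[\alpha,A]^u_v$ converges absolutely at each point of $J$; and for each $l\ge0$ with $(\beta)_l\neq0$: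 if $\beta-l\le0$, then $\sum_kI^{l-\beta}\bigl|G_k[\alpha,A]^u_v\bigr|<\infty$ at each point of $J$; if $\beta-l>0$, then each point of $J$ has a neighbourhood on which the series $\sum_kD^{\beta-l}G_k[\alpha,A]^u_v$ is dominated in absolute value by a convergent series of constants; 4. (convergence of the series for $\nabla^\beta(\nabla^\alpha A)$) at each point of $J$ and for all $j,i,u,v,w,z$ the multiple series over $k,m,r\in\mathbb N^{p+q}$ with terms $$F(k)^{j,v}_{u,i}\,\frac{(\beta)_{|k|}}{k!}\cdot f_1^{(r_1)}\cdots f_{p+q}^{(r_{p+q})}\;D^{\beta-|k|-|r|}\bigl(D^{\alpha-|m|}A^w_z\bigr)\,\frac{(\beta-|k|)_{|r|}}{r!}\,\frac{(\alpha)_{|m|}}{m!}$$ converges absolutely, where $f_1,\dots,f_{p+q}$ are the factors of $F(m)^{u,z}_{w,v}$. **Conclusion.** The derivatives $D^{\beta-l}$ of the components of $\nabla^\alpha A$ are defined on $J$ for all $l$ with $(\beta)_l\ne0$, the series defining $\nabla^\beta(\nabla^\alpha A)$ and $\nabla^{\alpha+\beta}A$ converge absolutely at each point of $J$, and $$\nabla^\beta\bigl(\nabla^\alpha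 A^{j_1\cdots j_p}_{i_1\cdots i_q}\bigr)=\nabla^{\alpha+\beta}A^{j_1\cdots j_p}_{i_1\cdots i_q}\quad\text{on }J .$$ -/

import Mathlib

open scoped ContDiff Nat

noncomputable section

namespace FracCov

/-! ### Ordinary (Riemann-Liouville) fractional derivatives with lower terminal `a ∈ [-∞, ∞)` -/

/-- The real points of the open interval with extended real end points `a`, `c`. -/
def interval (a c : EReal) : Set ℝ := {s : ℝ | a < (s : EReal) ∧ (s : EReal) < c}

/-- The fractional integral of order `μ ≥ 0`,
`(I^μ f)(s) = Γ(μ)⁻¹ ∫_{a}^{s} (s - t)^(μ - 1) f(t) dt` for `μ > 0`, and `I^0 f = f`. -/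
def fracInt (a : EReal) (μ : ℝ) (f : ℝ → ℝ) (s : ℝ) : ℝ :=
  if μ = 0 then f s
  else (Real.Gamma μ)⁻¹ * ∫ t in interval a s, (s - t) ^ (μ - 1) * f t

/-- The fractional derivative of real order `γ`: `D^γ f = (d/ds)^n I^(n - γ) f` where `n` is the
least natural number with `n ≥ γ`.  Thus `D^γ = I^(-γ)` for `γ ≤ 0`, and `D^γ` is the usual
derivative of order `γ` if `γ` is a natural number. -/
def fracDeriv (a : EReal) (γ : ℝ) (f : ℝ → ℝ) : ℝ → ℝ :=
  iteratedDeriv ⌈γ⌉₊ (fracInt a (⌈γ⌉₊ - γ) f)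

/-- `D^γ f` is defined on the interval `(a, c)`: the integral `I^(n - γ) f` converges absolutely at
each point of `(a, c)` and `I^(n - γ) f` is `n` times differentiable there. -/
def FracDefined (a c : EReal) (γ : ℝ) (f : ℝ → ℝ) : Prop :=
  ((⌈γ⌉₊ : ℝ) - γ ≠ 0 → ∀ s ∈ interval a c,
    MeasureTheory.IntegrableOn (fun t => (s - t) ^ ((⌈γ⌉₊ : ℝ) - γ - 1) * f t) (interval a s)) ∧
  ∀ i < ⌈γ⌉₊, DifferentiableOn ℝ (iteratedDeriv i (fracInt a (⌈γ⌉₊ - γ) f)) (interval a c)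

/-- `α (α - 1) ⋯ (α - k + 1)`, which is `1` for `k = 0`. -/
def falling (α : ℝ) (k : ℕ) : ℝ := (descPochhammer ℝ k).eval α

/-- `α (α - 1) ⋯ (α - |m| + 1) / m!` for a multi-index `m`. -/
def coef {ι : Type} [Fintype ι] (α : ℝ) (m : ι → ℕ) : ℝ :=
  falling α (∑ e, m e) / ∏ e, ((m e)! : ℝ)

/-- The semigroup rule `D^γ (D^δ f) = D^(γ + δ) f` holds on `(a, c)`; all the fractional
derivatives in it are defined. -/
def SemigroupRule (a c : EReal) (γ δ : ℝ) (f : ℝ → ℝ) : Prop :=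
  FracDefined a c δ f ∧ FracDefined a c γ (fracDeriv a δ f) ∧ FracDefined a c (γ + δ) f ∧
  ∀ s ∈ interval a c, fracDeriv a γ (fracDeriv a δ f) s = fracDeriv a (γ + δ) f s

/-- The generalized Leibniz rule holds on `(a, c)` for the fractional derivative of order `γ` of
the product of the functions `f e` and `h`: that derivative is defined and is the sum of the
absolutely convergent multiple series
`∑_r (∏ e, (f e)^(r e)) D^(γ - |r|) h · γ (γ - 1) ⋯ (γ - |r| + 1) / r!`. -/
def LeibnizRule {ι : Type} [Fintype ι] (a c : EReal) (γ : ℝ) (f : ι → ℝ → ℝ) (h : ℝ → ℝ) : Prop :=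
  FracDefined a c γ (fun t => (∏ e, f e t) * h t) ∧
  ∀ s ∈ interval a c,
    HasSum (fun r : ι → ℕ => (∏ e, iteratedDeriv (r e) (f e) s) *
        fracDeriv a (γ - ((∑ e, r e : ℕ) : ℝ)) h s * coef γ r)
      (fracDeriv a γ (fun t => (∏ e, f e t) * h t) s)

/-- Convergence of the series `∑_k D^γ (G k)` on `(a, c)`.  For `γ ≤ 0` this asks for absolute
convergence of the series of integrals, `∑_k I^(-γ) |G k| < ∞` at each point; for `γ > 0` it asks
for absolute and locally uniform convergence of the series of derivatives (locally, the series is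
dominated by a convergent numerical series). -/
def FracSummable (a c : EReal) (γ : ℝ) (G : ℕ → ℝ → ℝ) : Prop :=
  (γ ≤ 0 → ∀ s ∈ interval a c, Summable fun k => fracInt a (-γ) (fun t => |G k t|) s) ∧
  (0 < γ → ∀ s ∈ interval a c, ∃ U ∈ nhds s, ∃ M : ℕ → ℝ, Summable M ∧
    ∀ k, ∀ t ∈ U, |fracDeriv a γ (G k) t| ≤ M k)

/-! ### The symbols `P` and `Q` and the fractional covariant derivative -/

/-- `Γ^i_{jl}(x(s)) dx^l/ds`, with `Γ y i j l` standing for `Γ^i_{jl}(y)`. -/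
def conn {n : ℕ} (Γ : (Fin n → ℝ) → Fin n → Fin n → Fin n → ℝ) (x : ℝ → Fin n → ℝ)
    (s : ℝ) (i j : Fin n) : ℝ :=
  ∑ l, Γ (x s) i j l * deriv (fun t => x t l) s

/-- `symP Γ x k i j s` is `P^{i<k>}_j` at `s`.  The recursion at `k = 0` gives `P^{<1>}` equal
to `conn Γ x`. -/
def symP {n : ℕ} (Γ : (Fin n → ℝ) → Fin n → Fin n → Fin n → ℝ) (x : ℝ → Fin n → ℝ) :
    ℕ → Fin n → Fin n → ℝ → ℝ
  | 0 => fun i j _ => if i = j then 1 else 0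
  | k + 1 => fun i j s =>
      deriv (symP Γ x k i j) s + ∑ l, symP Γ x k l j s * conn Γ x s i l

/-- `symQ Γ x k i j s` is `Q^{i<k>}_j` at `s`.  The recursion at `k = 0` gives `Q^{<1>}` equal
to `-conn Γ x`. -/
def symQ {n : ℕ} (Γ : (Fin n → ℝ) → Fin n → Fin n → Fin n → ℝ) (x : ℝ → Fin n → ℝ) :
    ℕ → Fin n → Fin n → ℝ → ℝ
  | 0 => fun i j _ => if i = j then 1 else 0
  | k + 1 => fun i j s =>
      deriv (symQ Γ x k i j) s + ∑ l, symQ Γ x k i l s * (-conn Γ x s l j)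

/-- The components `A j i = A^{j_1 ⋯ j_p}_{i_1 ⋯ i_q}`, as functions of the parameter of the
curve, of a tensor field of type `(p, q)` along the curve. -/
abbrev TensorAlong (n p q : ℕ) : Type := (Fin p → Fin n) → (Fin q → Fin n) → ℝ → ℝ

/-- Multi-indices `(m_1, …, m_p, l_1, …, l_q)`: `m_e` is the value at `Sum.inl e`, and `l_e` is the
value at `Sum.inr e`. -/
abbrev MultiIndex (p q : ℕ) : Type := Fin p ⊕ Fin q → ℕ

/-- The `p + q` functions `P^{j_1<m_1>}_{u_1}, …, P^{j_p<m_p>}_{u_p}`,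
`Q^{v_1<l_1>}_{i_1}, …, Q^{v_q<l_q>}_{i_q}`. -/
def factor {n p q : ℕ} (Γ : (Fin n → ℝ) → Fin n → Fin n → Fin n → ℝ) (x : ℝ → Fin n → ℝ)
    (j : Fin p → Fin n) (i : Fin q → Fin n) (u : Fin p → Fin n) (v : Fin q → Fin n)
    (m : MultiIndex p q) : Fin p ⊕ Fin q → ℝ → ℝ
  | Sum.inl e => symP Γ x (m (Sum.inl e)) (j e) (u e)
  | Sum.inr e => symQ Γ x (m (Sum.inr e)) (v e) (i e)

/-- The `k`-th term of the series defining `∇^α A`. -/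
def nablaTerm {n p q : ℕ} (a : EReal) (Γ : (Fin n → ℝ) → Fin n → Fin n → Fin n → ℝ)
    (x : ℝ → Fin n → ℝ) (α : ℝ) (A : TensorAlong n p q) (j : Fin p → Fin n) (i : Fin q → Fin n)
    (k : ℕ) (s : ℝ) : ℝ :=
  ∑ m ∈ Finset.piAntidiag (Finset.univ : Finset (Fin p ⊕ Fin q)) k,
    ∑ u : Fin p → Fin n, ∑ v : Fin q → Fin n,
      (∏ e, factor Γ x j i u v m e s) * fracDeriv a (α - k) (A u v) s * coef α m

/-- The fractional covariant derivative `∇^α A` along the curve `x`. -/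
def nabla {n p q : ℕ} (a : EReal) (Γ : (Fin n → ℝ) → Fin n → Fin n → Fin n → ℝ)
    (x : ℝ → Fin n → ℝ) (α : ℝ) (A : TensorAlong n p q) : TensorAlong n p q :=
  fun j i s => ∑' k : ℕ, nablaTerm a Γ x α A j i k s

/-- The term with multi-indices `k`, `m`, `r` of the multiple series that results from
`∇^β (∇^α A)` if the series of `∇^α A` is inserted into that of `∇^β` and each term is expanded
by the generalized Leibniz rule. -/
def doubleTerm {n p q : ℕ} (a : EReal) (Γ : (Fin n → ℝ) → Fin n → Fin n → Fin n → ℝ)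
    (x : ℝ → Fin n → ℝ) (α β : ℝ) (A : TensorAlong n p q) (j : Fin p → Fin n) (i : Fin q → Fin n)
    (u : Fin p → Fin n) (v : Fin q → Fin n) (w : Fin p → Fin n) (z : Fin q → Fin n) (s : ℝ)
    (k m r : MultiIndex p q) : ℝ :=
  (∏ e, factor Γ x j i u v k e s) * coef β k *
    ((∏ e, iteratedDeriv (r e) (factor Γ x u v w z m e) s) *
      fracDeriv a (β - ((∑ e, k e : ℕ) : ℝ) - ((∑ e, r e : ℕ) : ℝ))
        (fracDeriv a (α - ((∑ e, m e : ℕ) : ℝ)) (A w z)) s *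
      coef (β - ((∑ e, k e : ℕ) : ℝ)) r * coef α m)

end FracCov

end

noncomputable section

namespace FracCov

/-! ### The interval and successive derivatives on open sets -/

/-! Heuristically, if Y is a matrix with Y' = YC, where C is the matrix `conn`, then P^{<k>} = Y⁻¹
Y^(k), and Q^{<k>} is the analogue for Y⁻¹. By the Leibniz rule ∇^α is then D^α conjugated by a
parallel frame, so it inherits the semigroup rule. The proof carries this out on the series
themselves.

Both sides are regroupings of one absolutely convergent series over (k, m, r), with terms
`doubleTerm`. Summing over r by the Leibniz rule, then over m by termwise fractional differentiation
(`fracDeriv_tsum`), then over k, gives ∇^β(∇^α A): `hasSum_nablaTerm_nabla`.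

In the other grouping (`hasSum_nablaTerm_add`) the semigroup rule turns the derivatives into
D^{α+β-|k+r+m|} A, and (β)_{|k|} (β-|k|)_{|r|} = (β)_{|k+r|}. For fixed t = k + r and m, the sum of
F(k) ∂^r F(m) / (k! r!) is F(t+m)/t!, by `leibniz_recursion` in each tensor slot. For fixed M = t +
m, the multi-index Chu-Vandermonde identity `sum_antidiag_falling` yields the coefficient
(α+β)_{|M|}/M!. -/

theorem isOpen_interval (a c : EReal) : IsOpen (interval a c) :=
  (isOpen_lt continuous_const continuous_coe_real_ereal).inter
    (isOpen_lt continuous_coe_real_ereal continuous_const)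

theorem interval_subset {a c : EReal} {s : ℝ} (hs : s ∈ interval a c) :
    interval a s ⊆ interval a c := fun _ ht => ⟨ht.1, ht.2.trans hs.2⟩

/-- A chain of functions, each the derivative of the previous one on an open set, consists of the
iterated derivatives of its first term. -/
theorem iteratedDeriv_eqOn_of_chain {J : Set ℝ} (hJ : IsOpen J) {N : ℕ} {f : ℝ → ℝ}
    {H : ℕ → ℝ → ℝ} (h0 : Set.EqOn f (H 0) J)
    (hH : ∀ i < N, ∀ s ∈ J, HasDerivAt (H i) (H (i + 1) s) s) :
    ∀ i ≤ N, Set.EqOn (iteratedDeriv i f) (H i) J := by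
  intro i
  induction i with
  | zero => intro _; simpa [iteratedDeriv_zero] using h0
  | succ i ih =>
    intro hi s hs
    have h := (ih (by omega)).eventuallyEq_of_mem (hJ.mem_nhds hs)
    rw [iteratedDeriv_succ, h.deriv_eq, (hH i (by omega) s hs).deriv]

theorem differentiableOn_iteratedDeriv_of_chain {J : Set ℝ} (hJ : IsOpen J) {N : ℕ} {f : ℝ → ℝ}
    {H : ℕ → ℝ → ℝ} (h0 : Set.EqOn f (H 0) J)
    (hH : ∀ i < N, ∀ s ∈ J, HasDerivAt (H i) (H (i + 1) s) s) (i : ℕ) (hi : i < N) :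
    DifferentiableOn ℝ (iteratedDeriv i f) J :=
  DifferentiableOn.congr (fun s hs => (hH i hi s hs).differentiableAt.differentiableWithinAt)
    (iteratedDeriv_eqOn_of_chain hJ h0 hH i hi.le)

theorem hasDerivAt_iteratedDeriv {J : Set ℝ} (hJ : IsOpen J) {f : ℝ → ℝ} {i : ℕ}
    (hf : DifferentiableOn ℝ (iteratedDeriv i f) J) {s : ℝ} (hs : s ∈ J) :
    HasDerivAt (iteratedDeriv i f) (iteratedDeriv (i + 1) f s) s := by
  rw [iteratedDeriv_succ]
  exact (hf.differentiableAt (hJ.mem_nhds hs)).hasDerivAt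

/-! ### Linearity of the fractional derivative -/

/-- The integrand of the fractional integral of order `μ` is integrable if `μ ≠ 0`. -/
def FracIntegrable (a c : EReal) (μ : ℝ) (f : ℝ → ℝ) : Prop :=
  μ ≠ 0 → ∀ s ∈ interval a c,
    MeasureTheory.IntegrableOn (fun t => (s - t) ^ (μ - 1) * f t) (interval a s)

theorem fracIntegrable_sum {ι : Type*} {a c : EReal} {μ : ℝ} (S : Finset ι) {f : ι → ℝ → ℝ}
    {b : ι → ℝ} (hf : ∀ i ∈ S, FracIntegrable a c μ (f i)) :
    FracIntegrable a c μ (fun t => ∑ i ∈ S, b i * f i t) := by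
  intro hμ s hs
  have := MeasureTheory.integrable_finsetSum S
    (fun i hi => (hf i hi hμ s hs).const_mul (b i))
  refine this.congr (Filter.Eventually.of_forall fun t => ?_)
  simp only [Finset.mul_sum]
  exact Finset.sum_congr rfl fun i _ => by ring

theorem fracInt_sum {ι : Type*} {a c : EReal} {μ : ℝ} (S : Finset ι) {f : ι → ℝ → ℝ} {b : ι → ℝ}
    (hf : ∀ i ∈ S, FracIntegrable a c μ (f i)) {s : ℝ} (hs : s ∈ interval a c) :
    fracInt a μ (fun t => ∑ i ∈ S, b i * f i t) s = ∑ i ∈ S, b i * fracInt a μ (f i) s := by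
  unfold fracInt
  split_ifs with hμ
  · rfl
  · have : ∀ t, (s - t) ^ (μ - 1) * ∑ i ∈ S, b i * f i t =
        ∑ i ∈ S, b i * ((s - t) ^ (μ - 1) * f i t) := fun t => by
      rw [Finset.mul_sum]; exact Finset.sum_congr rfl fun i _ => by ring
    simp_rw [this]
    rw [MeasureTheory.integral_finsetSum S (fun i hi => (hf i hi hμ s hs).const_mul (b i)),
      Finset.mul_sum]
    refine Finset.sum_congr rfl fun i _ => ?_
    rw [MeasureTheory.integral_const_mul]; ring

theorem fracDeriv_sum_aux {ι : Type*} {a c : EReal} {γ : ℝ} (S : Finset ι) {f : ι → ℝ → ℝ}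
    {b : ι → ℝ} (hf : ∀ i ∈ S, FracDefined a c γ (f i)) :
    FracDefined a c γ (fun t => ∑ i ∈ S, b i * f i t) ∧
    ∀ s ∈ interval a c, fracDeriv a γ (fun t => ∑ i ∈ S, b i * f i t) s =
      ∑ i ∈ S, b i * fracDeriv a γ (f i) s := by
  have h0 : Set.EqOn (fracInt a (⌈γ⌉₊ - γ) (fun t => ∑ i ∈ S, b i * f i t))
      (fun s => ∑ i ∈ S, b i * iteratedDeriv 0 (fracInt a (⌈γ⌉₊ - γ) (f i)) s)
      (interval a c) := fun s hs => by
    simpa using fracInt_sum S (fun i hi => (hf i hi).1) hs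
  -- The combinations of the k-th derivatives of the fractional integrals form a derivative chain.
  have hH : ∀ k < ⌈γ⌉₊, ∀ s ∈ interval a c, HasDerivAt
      (fun s => ∑ i ∈ S, b i * iteratedDeriv k (fracInt a (⌈γ⌉₊ - γ) (f i)) s)
      (∑ i ∈ S, b i * iteratedDeriv (k + 1) (fracInt a (⌈γ⌉₊ - γ) (f i)) s) s :=
    fun k hk s hs => HasDerivAt.fun_sum fun i hi =>
      (hasDerivAt_iteratedDeriv (isOpen_interval a c) ((hf i hi).2 k hk) hs).const_mul _
  refine ⟨⟨fracIntegrable_sum S fun i hi => (hf i hi).1, fun i hi => ?_⟩, fun s hs => ?_⟩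
  · exact differentiableOn_iteratedDeriv_of_chain (H := fun k s =>
      ∑ i ∈ S, b i * iteratedDeriv k (fracInt a (⌈γ⌉₊ - γ) (f i)) s)
      (isOpen_interval a c) h0 hH i hi
  · exact iteratedDeriv_eqOn_of_chain (H := fun k s =>
      ∑ i ∈ S, b i * iteratedDeriv k (fracInt a (⌈γ⌉₊ - γ) (f i)) s)
      (isOpen_interval a c) h0 hH _ le_rfl hs

/-- The fractional derivative of a finite linear combination; only the terms with nonzero
coefficient need a fractional derivative. -/
theorem fracDeriv_sum {ι : Type*} {a c : EReal} {γ : ℝ} (S : Finset ι) {f : ι → ℝ → ℝ}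
    {b : ι → ℝ} (hf : ∀ i ∈ S, b i ≠ 0 → FracDefined a c γ (f i)) :
    FracDefined a c γ (fun t => ∑ i ∈ S, b i * f i t) ∧
    ∀ s ∈ interval a c, fracDeriv a γ (fun t => ∑ i ∈ S, b i * f i t) s =
      ∑ i ∈ S, b i * fracDeriv a γ (f i) s := by
  classical
  have h := fracDeriv_sum_aux (a := a) (c := c) (γ := γ) (S.filter fun i => b i ≠ 0) (f := f)
    (b := b) (fun i hi => hf i (Finset.mem_filter.1 hi).1 (Finset.mem_filter.1 hi).2)
  have e : ∀ g : ι → ℝ, ∑ i ∈ S.filter (fun i => b i ≠ 0), b i * g i = ∑ i ∈ S, b i * g i :=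
    fun g => Finset.sum_filter_of_ne fun i _ h => left_ne_zero_of_mul h
  simpa only [e] using h

/-! ### Termwise fractional differentiation of series -/

/-- The sum is an a.e. limit of measurable partial sums, and its norm has integral at most the sum
of the integrals of the norms. `FracDefined` requires this integrability besides the value of the
integral. -/
theorem integrable_tsum {X : Type*} [MeasurableSpace X] {ρ : MeasureTheory.Measure X}
    {F : ℕ → X → ℝ} {f : X → ℝ} (hF : ∀ k, MeasureTheory.Integrable (F k) ρ)
    (hn : Summable fun k => ∫ t, ‖F k t‖ ∂ρ) (hs : ∀ᵐ t ∂ρ, Summable fun k => F k t)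
    (hf : ∀ t, ∑' k, F k t = f t) : MeasureTheory.Integrable f ρ := by
  obtain rfl : (fun t => ∑' k, F k t) = f := funext hf
  refine ⟨aestronglyMeasurable_of_tendsto_ae Filter.atTop
    (f := fun N t => ∑ k ∈ Finset.range N, F k t)
    (fun N => Finset.aestronglyMeasurable_fun_sum _ fun k _ => (hF k).1)
    (hs.mono fun t ht => ht.hasSum.tendsto_sum_nat), ?_⟩
  have h1 : ∫⁻ t, ‖∑' k, F k t‖ₑ ∂ρ ≤ ∑' k, ∫⁻ t, ‖F k t‖ₑ ∂ρ := by
    rw [← MeasureTheory.lintegral_tsum fun k => (hF k).1.enorm]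
    exact MeasureTheory.lintegral_mono fun t => enorm_tsum_le_tsum_enorm
  refine h1.trans_lt ?_
  have h2 : ∀ k, ∫⁻ t, ‖F k t‖ₑ ∂ρ = ENNReal.ofReal (∫ t, ‖F k t‖ ∂ρ) := fun k =>
    (MeasureTheory.ofReal_integral_norm_eq_lintegral_enorm (hF k)).symm
  simp_rw [h2]
  exact hn.tsum_ofReal_lt_top

theorem fracInt_tsum {a c : EReal} {μ : ℝ} (hμ : 0 ≤ μ) {G : ℕ → ℝ → ℝ}
    (hG : ∀ k, FracIntegrable a c μ (G k)) (hpt : ∀ s ∈ interval a c, Summable fun k => G k s)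
    (hI : ∀ s ∈ interval a c, Summable fun k => fracInt a μ (fun t => |G k t|) s) :
    FracIntegrable a c μ (fun t => ∑' k, G k t) ∧
    ∀ s ∈ interval a c, HasSum (fun k => fracInt a μ (G k) s)
      (fracInt a μ (fun t => ∑' k, G k t) s) := by
  rcases hμ.eq_or_lt with rfl | hμ
  · refine ⟨fun h => absurd rfl h, fun s hs => ?_⟩
    simpa [fracInt] using (hpt s hs).hasSum
  have key : ∀ s ∈ interval a c,
      MeasureTheory.IntegrableOn (fun t => (s - t) ^ (μ - 1) * ∑' k, G k t) (interval a s) ∧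
      HasSum (fun k => ∫ t in interval a s, (s - t) ^ (μ - 1) * G k t)
        (∫ t in interval a s, (s - t) ^ (μ - 1) * ∑' k, G k t) := by
    intro s hs
    have hm : MeasurableSet (interval a s) := (isOpen_interval a s).measurableSet
    have hΓ : (Real.Gamma μ)⁻¹ ≠ 0 := inv_ne_zero (Real.Gamma_pos_of_pos hμ).ne'
    have hFint := fun k => hG k hμ.ne' s hs
    have hn : Summable fun k => ∫ t in interval a s, ‖(s - t) ^ (μ - 1) * G k t‖ := by
      -- The kernel is nonnegative for t < s, so I^μ |G k| is, up to the factor 1/Γ(μ), the L¹ norm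
      -- of the k-th integrand.
      have h := hI s hs
      simp only [fracInt, hμ.ne', if_false] at h
      refine ((summable_mul_left_iff hΓ).1 h).congr fun k => ?_
      refine MeasureTheory.setIntegral_congr_fun hm fun t ht => ?_
      have : t ≤ s := (EReal.coe_lt_coe_iff.1 ht.2).le
      simp only [norm_mul, Real.norm_eq_abs]
      rw [abs_of_nonneg (Real.rpow_nonneg (sub_nonneg.2 this) _)]
    have hs1 := MeasureTheory.hasSum_integral_of_summable_integral_norm hFint hn
    simp only [tsum_mul_left] at hs1
    refine ⟨integrable_tsum hFint hn ?_ fun t => tsum_mul_left, hs1⟩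
    refine (MeasureTheory.ae_restrict_iff' hm).2 (Filter.Eventually.of_forall fun t ht => ?_)
    exact (hpt t (interval_subset hs ht)).mul_left _
  refine ⟨fun _ s hs => (key s hs).1, fun s hs => ?_⟩
  simp only [fracInt, hμ.ne', if_false]
  exact (key s hs).2.mul_left _

/-- The order γ - ⌈γ⌉₊ ≤ 0 allows interchanging sum and fractional integral; the remaining, positive
orders dominate the successive derivatives of that integral, so the series can be differentiated
termwise ⌈γ⌉₊ times. -/
theorem fracDeriv_tsum {a c : EReal} {γ : ℝ} {G : ℕ → ℝ → ℝ}
    (hG : ∀ k, FracDefined a c γ (G k)) (hpt : ∀ s ∈ interval a c, Summable fun k => G k s)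
    (hD : ∀ i ≤ ⌈γ⌉₊, FracSummable a c (γ - i) G) :
    FracDefined a c γ (fun t => ∑' k, G k t) ∧
    ∀ s ∈ interval a c, HasSum (fun k => fracDeriv a γ (G k) s)
      (fracDeriv a γ (fun t => ∑' k, G k t) s) := by
  have hJ := isOpen_interval a c
  have hν : 0 ≤ (⌈γ⌉₊ : ℝ) - γ := sub_nonneg.2 (Nat.le_ceil γ)
  obtain ⟨hi, hs0⟩ := fracInt_tsum hν (fun k => (hG k).1) hpt (fun s hs => by
    simpa using (hD _ le_rfl).1 (by linarith) s hs)
  set g : ℕ → ℝ → ℝ := fun k => fracInt a (⌈γ⌉₊ - γ) (G k) with hg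
  have hdom : ∀ i < ⌈γ⌉₊, ∀ s ∈ interval a c, ∃ U ∈ nhds s, ∃ M : ℕ → ℝ, Summable M ∧
      ∀ k, ∀ t ∈ U, |iteratedDeriv (i + 1) (g k) t| ≤ M k := by
    intro i hi s hs
    -- Lowering γ by ⌈γ⌉₊ - (i + 1) leaves an order with ceiling i + 1 and the same integral part
    -- I^{⌈γ⌉₊ - γ}; its fractional derivative is therefore the (i + 1)-th derivative of `g k`.
    have hlt : ((⌈γ⌉₊ - (i + 1) : ℕ) : ℝ) < γ := Nat.lt_ceil.1 (by omega)
    have hceil : ⌈γ - ((⌈γ⌉₊ - (i + 1) : ℕ) : ℝ)⌉₊ = i + 1 := by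
      rw [Nat.ceil_sub_natCast]; omega
    have hcast : ((⌈γ⌉₊ - (i + 1) : ℕ) : ℝ) = ⌈γ⌉₊ - (i + 1 : ℕ) := Nat.cast_sub (by omega)
    have := (hD (⌈γ⌉₊ - (i + 1)) (by omega)).2 (by linarith) s hs
    unfold fracDeriv at this
    rw [hceil] at this
    have h2 : ((i + 1 : ℕ) : ℝ) - (γ - ((⌈γ⌉₊ - (i + 1) : ℕ) : ℝ)) = ⌈γ⌉₊ - γ := by
      rw [hcast]; ring
    rwa [h2] at this
  have hsum : ∀ i ≤ ⌈γ⌉₊, ∀ s ∈ interval a c, Summable fun k => iteratedDeriv i (g k) s := by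
    intro i hi s hs
    cases i with
    | zero => simpa using (hs0 s hs).summable
    | succ i =>
      obtain ⟨U, hU, M, hM, hb⟩ := hdom i (by omega) s hs
      exact .of_norm_bounded hM fun k => hb k s (mem_of_mem_nhds hU)
  have hder : ∀ i < ⌈γ⌉₊, ∀ s ∈ interval a c,
      HasDerivAt (fun t => ∑' k, iteratedDeriv i (g k) t)
        (∑' k, iteratedDeriv (i + 1) (g k) s) s := by
    intro i hi s hs
    obtain ⟨U, hU, M, hM, hb⟩ := hdom i hi s hs
    obtain ⟨ε, hε, hball⟩ := Metric.mem_nhds_iff.1 (Filter.inter_mem hU (hJ.mem_nhds hs))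
    exact hasDerivAt_tsum_of_isPreconnected hM Metric.isOpen_ball
      (convex_ball s ε).isPreconnected
      (fun k t ht => hasDerivAt_iteratedDeriv hJ ((hG k).2 i hi) (hball ht).2)
      (fun k t ht => hb k t (hball ht).1) (Metric.mem_ball_self hε) (hsum i hi.le s hs)
      (Metric.mem_ball_self hε)
  have h0 : Set.EqOn (fracInt a (⌈γ⌉₊ - γ) (fun t => ∑' k, G k t))
      (fun t => ∑' k, iteratedDeriv 0 (g k) t) (interval a c) := fun s hs => by
    simpa using (hs0 s hs).tsum_eq.symm
  refine ⟨⟨hi, differentiableOn_iteratedDeriv_of_chain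
    (H := fun i t => ∑' k, iteratedDeriv i (g k) t) hJ h0 hder⟩, fun s hs => ?_⟩
  have := iteratedDeriv_eqOn_of_chain
    (H := fun i t => ∑' k, iteratedDeriv i (g k) t) hJ h0 hder _ le_rfl hs
  unfold fracDeriv
  rw [this]
  exact (hsum _ le_rfl s hs).hasSum

/-! ### Falling factorials -/

theorem falling_eq_prod (α : ℝ) (k : ℕ) : falling α k = ∏ j ∈ Finset.range k, (α - j) :=
  descPochhammer_eval_eq_prod_range k α

theorem falling_add (α : ℝ) (k l : ℕ) :
    falling α (k + l) = falling α k * falling (α - k) l := by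
  simp only [falling_eq_prod, Finset.prod_range_add, Nat.cast_add, sub_sub]

/-- All factors γ - j with j < ⌈γ⌉₊ are positive. Hence the convergence hypotheses, restricted to
nonzero falling factorials, cover every order that `fracDeriv_tsum` needs. -/
theorem falling_ne_zero_of_le_ceil {γ : ℝ} {i : ℕ} (hi : i ≤ ⌈γ⌉₊) : falling γ i ≠ 0 := by
  rw [falling_eq_prod]
  refine Finset.prod_ne_zero_iff.2 fun j hj => ?_
  have : (j : ℝ) < γ := Nat.lt_ceil.1 ((Finset.mem_range.1 hj).trans_le hi)
  exact (sub_pos.2 this).ne'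

theorem smeval_descPochhammer (α : ℝ) (k : ℕ) :
    (descPochhammer ℤ k).smeval α = falling α k := by
  rw [falling_eq_prod]
  induction k with
  | zero => simp
  | succ k ih =>
    rw [descPochhammer_succ_right, Polynomial.smeval_mul, ih, Finset.prod_range_succ]
    simp [Polynomial.smeval_sub, Polynomial.smeval_natCast]

theorem falling_vandermonde (α β : ℝ) (N : ℕ) :
    ∑ y ∈ Finset.HasAntidiagonal.antidiagonal N, (N.choose y.1 : ℝ) * (falling α y.1 * falling β y.2) =
      falling (α + β) N := by
  have := Ring.descPochhammer_smeval_add N (Commute.all α β)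
  simp only [smeval_descPochhammer] at this
  exact this.symm

/-- Apart from the factorials only k + r enters, which permits grouping by k + r. -/
theorem coef_mul_coef {ι : Type} [Fintype ι] (β : ℝ) (k r : ι → ℕ) :
    coef β k * coef (β - ((∑ e, k e : ℕ) : ℝ)) r =
      falling β (∑ e, (k + r) e) / ((∏ e, ((k e)! : ℝ)) * ∏ e, ((r e)! : ℝ)) := by
  simp only [Pi.add_apply, Finset.sum_add_distrib, falling_add, coef]
  rw [div_mul_div_comm]

theorem coef_ne_zero {ι : Type} [Fintype ι] {α : ℝ} {m : ι → ℕ} (h : coef α m ≠ 0) : falling α (∑ e, m e) ≠ 0 :=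
  fun h0 => h (by simp [coef, h0])

/-! ### Sums over pairs of multi-indices with given sum -/

section Multi

variable {ι : Type} [Fintype ι] [DecidableEq ι]

/-- The pairs of multi-indices with sum `M`. -/
def antidiag (M : ι → ℕ) : Finset ((ι → ℕ) × (ι → ℕ)) :=
  (Fintype.piFinset fun e => Finset.HasAntidiagonal.antidiagonal (M e)).map
    (Equiv.arrowProdEquivProdArrow ι (fun _ => ℕ) (fun _ => ℕ)).toEmbedding

theorem mem_antidiag {M : ι → ℕ} {x : (ι → ℕ) × (ι → ℕ)} : x ∈ antidiag M ↔ x.1 + x.2 = M := by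
  simp only [antidiag, Finset.mem_map_equiv, Fintype.mem_piFinset, Finset.HasAntidiagonal.mem_antidiagonal,
    funext_iff, Equiv.arrowProdEquivProdArrow_symm_apply, Pi.add_apply]

theorem sum_antidiag_prod {R : Type*} [CommSemiring R] (M : ι → ℕ) (f : ι → ℕ → ℕ → R) :
    ∑ x ∈ antidiag M, ∏ e, f e (x.1 e) (x.2 e) =
      ∏ e, ∑ y ∈ Finset.HasAntidiagonal.antidiagonal (M e), f e y.1 y.2 := by
  rw [Finset.prod_univ_sum, antidiag, Finset.sum_map]
  rfl

theorem sum_add_of_mem_antidiag {M : ι → ℕ} {x : (ι → ℕ) × (ι → ℕ)} (hx : x ∈ antidiag M) :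
    ∑ e, x.1 e + ∑ e, x.2 e = ∑ e, M e := by
  rw [← mem_antidiag.1 hx, ← Finset.sum_add_distrib]; rfl

/-- Compare the coefficients of X^n in (1 + X)^{|M|} = ∏ (1 + X)^{M_e}. -/
theorem choose_sum_eq (M : ι → ℕ) (n : ℕ) :
    ((∑ e, M e).choose n : ℝ) =
      ∑ x ∈ antidiag M, if n = ∑ e, x.1 e then ∏ e, ((M e).choose (x.1 e) : ℝ) else 0 := by
  have h : (1 + Polynomial.X : Polynomial ℝ) ^ (∑ e, M e) = ∑ x ∈ antidiag M,
      ∏ e, (Polynomial.C ((M e).choose (x.1 e) : ℝ) * Polynomial.X ^ (x.1 e)) := by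
    rw [sum_antidiag_prod M fun e a _ =>
        Polynomial.C ((M e).choose a : ℝ) * (Polynomial.X : Polynomial ℝ) ^ a,
      ← Finset.prod_pow_eq_pow_sum]
    refine Finset.prod_congr rfl fun e _ => ?_
    rw [add_comm, (Commute.all _ _).add_pow']
    exact Finset.sum_congr rfl fun y _ => by simp
  have h2 := congrArg (fun P : Polynomial ℝ => P.coeff n) h
  simp only [Polynomial.coeff_one_add_X_pow, Polynomial.finsetSum_coeff, Finset.prod_mul_distrib,
    Finset.prod_pow_eq_pow_sum, ← map_prod, Polynomial.coeff_C_mul_X_pow] at h2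
  exact h2

theorem choose_div_factorial {N a b : ℕ} (h : a + b = N) :
    (N.choose a : ℝ) / (N ! : ℝ) = 1 / ((a ! : ℝ) * (b ! : ℝ)) := by
  subst h
  have h' : ((a + b).choose a : ℝ) * a ! * b ! = (a + b)! := by
    rw [Nat.choose_symm_add]
    exact_mod_cast Nat.add_choose_mul_factorial_mul_factorial a b
  have := Nat.factorial_pos a; have := Nat.factorial_pos b; have := Nat.factorial_pos (a + b)
  field_simp
  linarith

/-- Since M!/(k! r!) is a product of binomial coefficients, collecting the pairs with given |k| by
`choose_sum_eq` reduces the sum to one variable. -/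
theorem sum_antidiag_of_sum (M : ι → ℕ) (F : ℕ → ℕ → ℝ) :
    ∑ x ∈ antidiag M, F (∑ e, x.1 e) (∑ e, x.2 e) /
        ((∏ e, ((x.1 e)! : ℝ)) * ∏ e, ((x.2 e)! : ℝ)) =
      (∑ y ∈ Finset.HasAntidiagonal.antidiagonal (∑ e, M e), ((∑ e, M e).choose y.1 : ℝ) * F y.1 y.2) /
        ∏ e, ((M e)! : ℝ) := by
  simp_rw [choose_sum_eq, Finset.sum_mul]
  rw [Finset.sum_comm, Finset.sum_div]
  refine Finset.sum_congr rfl fun x hx => ?_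
  have hs := sum_add_of_mem_antidiag hx
  rw [Finset.sum_eq_single (∑ e, x.1 e, ∑ e, x.2 e)]
  · have : (∏ e, ((M e).choose (x.1 e) : ℝ)) / ∏ e, ((M e)! : ℝ) =
        1 / ((∏ e, ((x.1 e)! : ℝ)) * ∏ e, ((x.2 e)! : ℝ)) := by
      rw [← Finset.prod_div_distrib, ← Finset.prod_mul_distrib, one_div,
        ← Finset.prod_inv_distrib]
      exact Finset.prod_congr rfl fun e _ => by
        rw [choose_div_factorial (congrFun (mem_antidiag.1 hx) e), one_div]
    rw [if_pos rfl, mul_div_right_comm, this]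
    ring
  · intro y hy hne
    rw [if_neg, zero_mul]
    intro h
    rw [Finset.HasAntidiagonal.mem_antidiagonal] at hy
    exact hne (Prod.ext h (by simp only; omega))
  · intro h
    exact absurd (Finset.HasAntidiagonal.mem_antidiagonal.2 hs) h

/-- The Chu-Vandermonde identity for multi-indices. -/
theorem sum_antidiag_falling (α β : ℝ) (M : ι → ℕ) :
    ∑ x ∈ antidiag M, falling α (∑ e, x.1 e) * falling β (∑ e, x.2 e) /
        ((∏ e, ((x.1 e)! : ℝ)) * ∏ e, ((x.2 e)! : ℝ)) = coef (α + β) M := by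
  rw [sum_antidiag_of_sum M fun a b => falling α a * falling β b, falling_vandermonde, coef]

end Multi

/-! ### Iterated covariant derivatives of the symbols `P` and `Q` -/

theorem contDiffOn_iteratedDeriv {J : Set ℝ} (hJ : IsOpen J) {f : ℝ → ℝ}
    (hf : ContDiffOn ℝ ∞ f J) (r : ℕ) : ContDiffOn ℝ ∞ (iteratedDeriv r f) J := by
  induction r with
  | zero => simpa using hf
  | succ r ih =>
    rw [iteratedDeriv_succ]
    exact ih.deriv_of_isOpen hJ (by simp)

/-- Let `S k` be matrix functions such that `S 0 = 1` and `S (k + 1)` is the derivative of `S k`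
plus `C (S k)`. Then `S (t + m)` is obtained by applying `t` times the operator `d/ds + C` to `S m`,
expanded by the Leibniz rule. -/
theorem leibniz_recursion {ι : Type*} [Fintype ι] [DecidableEq ι] {J : Set ℝ} (hJ : IsOpen J)
    {S : ℕ → ι → ι → ℝ → ℝ} {C : ℝ → ι → ι → ℝ}
    (h0 : ∀ i j s, S 0 i j s = if i = j then 1 else 0)
    (hS : ∀ k i j s, S (k + 1) i j s = deriv (S k i j) s + ∑ l, S k l j s * C s i l)
    (hsm : ∀ k i j, ContDiffOn ℝ ∞ (S k i j) J) (m t : ℕ) (i w : ι) {s : ℝ} (hs : s ∈ J) :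
    ∑ x ∈ Finset.HasAntidiagonal.antidiagonal t, (t.choose x.1 : ℝ) *
      ∑ u, S x.1 i u s * iteratedDeriv x.2 (S m u w) s = S (t + m) i w s := by
  induction t generalizing i s with
  | zero => simp [h0]
  | succ t ih =>
    have hd : ∀ k i j, HasDerivAt (S k i j) (deriv (S k i j) s) s := fun k i j =>
      (((hsm k i j).differentiableOn (by simp)).differentiableAt (hJ.mem_nhds hs)).hasDerivAt
    have hdi : ∀ r i j, HasDerivAt (iteratedDeriv r (S m i j))
        (iteratedDeriv (r + 1) (S m i j) s) s := fun r i j => hasDerivAt_iteratedDeriv hJ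
          ((contDiffOn_iteratedDeriv hJ (hsm m i j) r).differentiableOn (by simp)) hs
    have hder : deriv (S (t + m) i w) s = ∑ x ∈ Finset.HasAntidiagonal.antidiagonal t, (t.choose x.1 : ℝ) *
        ∑ u, (deriv (S x.1 i u) s * iteratedDeriv x.2 (S m u w) s +
          S x.1 i u s * iteratedDeriv (x.2 + 1) (S m u w) s) := by
      have he : (fun s => ∑ x ∈ Finset.HasAntidiagonal.antidiagonal t, (t.choose x.1 : ℝ) *
          ∑ u, S x.1 i u s * iteratedDeriv x.2 (S m u w) s) =ᶠ[nhds s] S (t + m) i w :=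
        Filter.eventuallyEq_of_mem (hJ.mem_nhds hs) fun s hs => ih i hs
      rw [← he.deriv_eq]
      exact (HasDerivAt.fun_sum fun x _ => (HasDerivAt.fun_sum fun u _ =>
        (hd x.1 i u).mul (hdi x.2 u w)).const_mul _).deriv
    -- Pascal's rule splits the sum for t + 1 into terms with one more derivative on S m and terms
    -- with S (a + 1). Expanding the latter by `hS` gives the derivative of the induction hypothesis
    -- plus C times it.
    rw [Finset.sum_antidiagonal_choose_succ_mul
      (fun a b => ∑ u, S a i u s * iteratedDeriv b (S m u w) s), add_right_comm, hS, hder]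
    simp_rw [← fun l => ih l hs, Finset.sum_mul]
    rw [Finset.sum_comm (s := Finset.univ), ← Finset.sum_add_distrib, ← Finset.sum_add_distrib]
    refine Finset.sum_congr rfl fun x hx => ?_
    rw [← Nat.choose_symm_of_eq_add (Finset.HasAntidiagonal.mem_antidiagonal.1 hx).symm]
    simp_rw [mul_assoc]
    rw [← Finset.mul_sum, ← mul_add, ← mul_add]
    congr 1
    simp_rw [hS, add_mul, Finset.sum_add_distrib, Finset.sum_mul]
    rw [Finset.sum_comm (s := Finset.univ) (t := Finset.univ)]
    have : ∀ a b d : ℝ, a * b * d = a * d * b := fun a b d => by ring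
    simp_rw [this _ (C s i _)]
    ring

section Symbols

variable {n p q : ℕ} {a c : EReal} {V : Set (Fin n → ℝ)}
  {Γ : (Fin n → ℝ) → Fin n → Fin n → Fin n → ℝ} {x : ℝ → Fin n → ℝ}

theorem contDiffOn_conn (hΓ : ∀ i j l, ContDiffOn ℝ ∞ (fun y => Γ y i j l) V)
    (hx : ContDiffOn ℝ ∞ x (interval a c)) (hxV : ∀ s ∈ interval a c, x s ∈ V) (i j : Fin n) :
    ContDiffOn ℝ ∞ (fun s => conn Γ x s i j) (interval a c) :=
  ContDiffOn.sum fun l _ => ((hΓ i j l).comp hx hxV).mul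
    ((contDiffOn_pi.1 hx l).deriv_of_isOpen (isOpen_interval a c) (by simp))

theorem contDiffOn_symP (hC : ∀ i j, ContDiffOn ℝ ∞ (fun s => conn Γ x s i j) (interval a c))
    (k : ℕ) (i j : Fin n) : ContDiffOn ℝ ∞ (symP Γ x k i j) (interval a c) := by
  induction k generalizing i j with
  | zero => exact contDiffOn_const
  | succ k ih =>
    exact ((ih i j).deriv_of_isOpen (isOpen_interval a c) (by simp)).add
      (ContDiffOn.sum fun l _ => (ih l j).mul (hC i l))

theorem contDiffOn_symQ (hC : ∀ i j, ContDiffOn ℝ ∞ (fun s => conn Γ x s i j) (interval a c))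
    (k : ℕ) (i j : Fin n) : ContDiffOn ℝ ∞ (symQ Γ x k i j) (interval a c) := by
  induction k generalizing i j with
  | zero => exact contDiffOn_const
  | succ k ih =>
    exact ((ih i j).deriv_of_isOpen (isOpen_interval a c) (by simp)).add
      (ContDiffOn.sum fun l _ => (ih i l).mul (hC l j).neg)

/-- The entry at `e` of the matrix product of the symbols of order `k` and the derivatives of
order `r` of the symbols of order `m`. -/
def factorMul (Γ : (Fin n → ℝ) → Fin n → Fin n → Fin n → ℝ) (x : ℝ → Fin n → ℝ)
    (j : Fin p → Fin n) (i : Fin q → Fin n) (w : Fin p → Fin n) (z : Fin q → Fin n) (s : ℝ)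
    (m : MultiIndex p q) : Fin p ⊕ Fin q → ℕ → ℕ → ℝ
  | Sum.inl e, k, r => ∑ u, symP Γ x k (j e) u s *
      iteratedDeriv r (symP Γ x (m (Sum.inl e)) u (w e)) s
  | Sum.inr e, k, r => ∑ v, symQ Γ x k v (i e) s *
      iteratedDeriv r (symQ Γ x (m (Sum.inr e)) (z e) v) s

/-- Each summation index u_e or v_e occurs in one slot only, so distributivity turns the sum of
products into a product of matrix products. -/
theorem sum_prod_factor (j : Fin p → Fin n) (i : Fin q → Fin n) (w : Fin p → Fin n)
    (z : Fin q → Fin n) (s : ℝ) (k m r : MultiIndex p q) :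
    ∑ u : Fin p → Fin n, ∑ v : Fin q → Fin n, (∏ e, factor Γ x j i u v k e s) *
      ∏ e, iteratedDeriv (r e) (factor Γ x u v w z m e) s =
    ∏ e, factorMul Γ x j i w z s m e (k e) (r e) := by
  simp only [Fintype.prod_sum_type, factorMul, factor, Finset.prod_univ_sum,
    Fintype.piFinset_univ, Finset.sum_mul_sum, Finset.prod_mul_distrib]
  exact Finset.sum_congr rfl fun u _ => Finset.sum_congr rfl fun v _ => by ring

theorem sum_antidiagonal_factorMul
    (hC : ∀ i j, ContDiffOn ℝ ∞ (fun s => conn Γ x s i j) (interval a c))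
    (j : Fin p → Fin n) (i : Fin q → Fin n) (w : Fin p → Fin n) (z : Fin q → Fin n) {s : ℝ}
    (hs : s ∈ interval a c) (m t : MultiIndex p q) (e : Fin p ⊕ Fin q) :
    ∑ y ∈ Finset.HasAntidiagonal.antidiagonal (t e), ((t e).choose y.1 : ℝ) * factorMul Γ x j i w z s m e y.1 y.2 =
      factor Γ x j i w z (t + m) e s := by
  cases e with
  | inl e =>
    exact leibniz_recursion (isOpen_interval a c) (S := symP Γ x) (C := conn Γ x)
      (fun _ _ _ => rfl) (fun _ _ _ _ => rfl) (contDiffOn_symP hC) _ _ _ _ hs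
  | inr e =>
    -- The recursion for Q multiplies on the right, so the transposed matrices satisfy the recursion
    -- of the lemma.
    exact leibniz_recursion (isOpen_interval a c) (S := fun k i j => symQ Γ x k j i)
      (C := fun s i j => -conn Γ x s j i)
      (fun i j _ => by simp only [symQ, eq_comm]) (fun _ _ _ _ => rfl)
      (fun k i j => contDiffOn_symQ hC k j i) _ _ _ _ hs

theorem sum_antidiag_factorMul
    (hC : ∀ i j, ContDiffOn ℝ ∞ (fun s => conn Γ x s i j) (interval a c))
    (j : Fin p → Fin n) (i : Fin q → Fin n) (w : Fin p → Fin n) (z : Fin q → Fin n) {s : ℝ}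
    (hs : s ∈ interval a c) (m t : MultiIndex p q) :
    ∑ y ∈ antidiag t, (∏ e, factorMul Γ x j i w z s m e (y.1 e) (y.2 e)) /
        ((∏ e, ((y.1 e)! : ℝ)) * ∏ e, ((y.2 e)! : ℝ)) =
      (∏ e, factor Γ x j i w z (t + m) e s) / ∏ e, ((t e)! : ℝ) := by
  simp_rw [← Finset.prod_mul_distrib, ← Finset.prod_div_distrib]
  rw [sum_antidiag_prod t fun e k r => factorMul Γ x j i w z s m e k r / ((k ! : ℝ) * (r ! : ℝ))]
  refine Finset.prod_congr rfl fun e _ => ?_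
  rw [← sum_antidiagonal_factorMul hC j i w z hs m t e, Finset.sum_div]
  refine Finset.sum_congr rfl fun y hy => ?_
  rw [mul_div_right_comm, choose_div_factorial (Finset.HasAntidiagonal.mem_antidiagonal.1 hy)]
  ring

end Symbols

/-! ### Regrouping of multiple series -/

/-- All regroupings below are sums over the finite fibres of an additive map on multi-indices. -/
theorem hasSum_fiber {X Y : Type*} {f : X → ℝ} {S : ℝ} (hf : HasSum f S) (g : X → Y)
    (F : Y → Finset X) (hF : ∀ x y, x ∈ F y ↔ g x = y) :
    HasSum (fun y => ∑ x ∈ F y, f x) S := by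
  refine (hf.tsum_fiberwise g).congr_fun fun y => ?_
  have : g ⁻¹' {y} = (F y : Set X) := by ext x; simp [hF]
  rw [this]
  exact ((F y).tsum_subtype f).symm

/-- The triple with middle entry `m` and the given outer entries. -/
def insertMiddle {X : Type*} (m : X) : X × X ↪ X × X × X where
  toFun b := (b.1, m, b.2)
  inj' _ _ h := Prod.ext (congrArg (fun K : X × X × X => K.1) h)
    (congrArg (fun K : X × X × X => K.2.2) h)

theorem insertMiddle_apply {X : Type*} (m : X) (b : X × X) :
    insertMiddle m b = (b.1, m, b.2) := rfl

/-! ### The two groupings of the multiple series -/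

section

variable {n p q : ℕ} {a c : EReal} {Γ : (Fin n → ℝ) → Fin n → Fin n → Fin n → ℝ}
  {x : ℝ → Fin n → ℝ} {α β : ℝ} {A : TensorAlong n p q}

theorem sum_doubleTerm {s : ℝ} (hs : s ∈ interval a c) (w : Fin p → Fin n) (z : Fin q → Fin n)
    (hsemi : ∀ k l : ℕ, falling α k ≠ 0 → falling β l ≠ 0 →
      SemigroupRule a c (β - l) (α - k) (A w z))
    (j : Fin p → Fin n) (i : Fin q → Fin n) (k m r : MultiIndex p q) :
    ∑ u, ∑ v, doubleTerm a Γ x α β A j i u v w z s k m r =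
      (∏ e, factorMul Γ x j i w z s m e (k e) (r e)) /
          ((∏ e, ((k e)! : ℝ)) * ∏ e, ((r e)! : ℝ)) *
        (falling β (∑ e, (k + r) e) * coef α m *
          fracDeriv a (α + β - ((∑ e, (k + r + m) e : ℕ) : ℝ)) (A w z) s) := by
  have hf : falling β (∑ e, (k + r) e) * coef α m *
      fracDeriv a (α + β - ((∑ e, (k + r + m) e : ℕ) : ℝ)) (A w z) s =
      falling β (∑ e, (k + r) e) * coef α m *
      fracDeriv a (β - ((∑ e, k e : ℕ) : ℝ) - ((∑ e, r e : ℕ) : ℝ))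
        (fracDeriv a (α - ((∑ e, m e : ℕ) : ℝ)) (A w z)) s := by
    -- The semigroup rule is available only for nonvanishing coefficients; otherwise both sides are
    -- zero.
    by_cases h : falling β (∑ e, (k + r) e) * coef α m = 0
    · simp only [h, zero_mul]
    · have := (hsemi _ _ (coef_ne_zero (right_ne_zero_of_mul h)) (left_ne_zero_of_mul h)).2.2.2 s hs
      have e1 : β - ((∑ e, (k + r) e : ℕ) : ℝ) =
          β - ((∑ e, k e : ℕ) : ℝ) - ((∑ e, r e : ℕ) : ℝ) := by
        simp only [Pi.add_apply, Finset.sum_add_distrib]; push_cast; ring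
      have e2 : β - ((∑ e, (k + r) e : ℕ) : ℝ) + (α - ((∑ e, m e : ℕ) : ℝ)) =
          α + β - ((∑ e, (k + r + m) e : ℕ) : ℝ) := by
        simp only [Pi.add_apply, Finset.sum_add_distrib]; push_cast; ring
      rw [e2, e1] at this
      rw [this]
  rw [hf, ← sum_prod_factor, div_mul_eq_mul_div, mul_div_assoc, Finset.sum_mul]
  refine Finset.sum_congr rfl fun u _ => ?_
  rw [Finset.sum_mul]
  refine Finset.sum_congr rfl fun v _ => ?_
  have := coef_mul_coef β k r
  rw [mul_assoc (falling β _), mul_div_right_comm, ← this, doubleTerm]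
  ring

theorem hasSum_nablaTerm_add
    (hC : ∀ i j, ContDiffOn ℝ ∞ (fun s => conn Γ x s i j) (interval a c))
    (hsemi : ∀ (w : Fin p → Fin n) (z : Fin q → Fin n) (k l : ℕ), falling α k ≠ 0 →
      falling β l ≠ 0 → SemigroupRule a c (β - l) (α - k) (A w z))
    {s : ℝ} (hs : s ∈ interval a c) (j : Fin p → Fin n) (i : Fin q → Fin n)
    (hsum : ∀ u v w z, Summable fun K : MultiIndex p q × MultiIndex p q × MultiIndex p q =>
        doubleTerm a Γ x α β A j i u v w z s K.1 K.2.1 K.2.2) :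
    HasSum (fun k => nablaTerm a Γ x (α + β) A j i k s)
      (∑ w, ∑ z, ∑ u, ∑ v, ∑' K : MultiIndex p q × MultiIndex p q × MultiIndex p q,
        doubleTerm a Γ x α β A j i u v w z s K.1 K.2.1 K.2.2) := by
  have key : ∀ w z, HasSum (fun M : MultiIndex p q =>
      (∏ e, factor Γ x j i w z M e s) *
        fracDeriv a (α + β - ((∑ e, M e : ℕ) : ℝ)) (A w z) s * coef (α + β) M)
      (∑ u, ∑ v, ∑' K : MultiIndex p q × MultiIndex p q × MultiIndex p q,
        doubleTerm a Γ x α β A j i u v w z s K.1 K.2.1 K.2.2) := by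
    intro w z
    have h0 := hasSum_sum (s := Finset.univ) fun u _ =>
      hasSum_sum (s := Finset.univ) fun v _ => (hsum u v w z).hasSum
    simp only [sum_doubleTerm hs w z (hsemi w z)] at h0
    -- Group first by (t, m) with t = k + r, where the symbols combine to F(t + m), and then by M =
    -- t + m.
    have h1 := hasSum_fiber h0 (fun K => (K.1 + K.2.2, K.2.1))
      (fun y => (antidiag y.1).map (insertMiddle y.2)) (fun K y => by
        obtain ⟨k, m, r⟩ := K
        obtain ⟨t, m'⟩ := y
        simp only [Finset.mem_map, mem_antidiag, insertMiddle_apply,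
          Prod.mk.injEq, Prod.exists]
        constructor
        · rintro ⟨k', r', h, h1, h2, h3⟩
          exact ⟨h1 ▸ h3 ▸ h, h2.symm⟩
        · rintro ⟨h1, h2⟩; exact ⟨k, r, h1, rfl, h2.symm, rfl⟩)
    have h2 := hasSum_fiber h1 (fun y => y.1 + y.2) antidiag (fun y M => mem_antidiag)
    refine h2.congr_fun fun M => ?_
    have e1 : ∀ y ∈ antidiag M, ∑ K ∈ (antidiag y.1).map (insertMiddle y.2),
        (∏ e, factorMul Γ x j i w z s K.2.1 e (K.1 e) (K.2.2 e)) /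
          ((∏ e, ((K.1 e)! : ℝ)) * ∏ e, ((K.2.2 e)! : ℝ)) *
        (falling β (∑ e, (K.1 + K.2.2) e) * coef α K.2.1 *
          fracDeriv a (α + β - ((∑ e, (K.1 + K.2.2 + K.2.1) e : ℕ) : ℝ)) (A w z) s) =
        falling β (∑ e, y.1 e) * falling α (∑ e, y.2 e) /
          ((∏ e, ((y.1 e)! : ℝ)) * ∏ e, ((y.2 e)! : ℝ)) *
        ((∏ e, factor Γ x j i w z M e s) *
          fracDeriv a (α + β - ((∑ e, M e : ℕ) : ℝ)) (A w z) s) := by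
      intro y hy
      rw [Finset.sum_map]
      have hM : y.1 + y.2 = M := mem_antidiag.1 hy
      have : ∀ b ∈ antidiag y.1, (b.1 + b.2 : MultiIndex p q) = y.1 := fun b => mem_antidiag.1
      simp only [insertMiddle_apply]
      rw [Finset.sum_congr rfl fun b hb => by rw [this b hb], ← Finset.sum_mul,
        sum_antidiag_factorMul hC j i w z hs, hM, coef]
      ring
    rw [Finset.sum_congr rfl e1, ← Finset.sum_mul, sum_antidiag_falling, add_comm β α]
    ring
  have h3 := hasSum_fiber (hasSum_sum (s := Finset.univ) fun w _ =>
      hasSum_sum (s := Finset.univ) fun z _ => key w z)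
    (fun M => ∑ e, M e) (fun N => Finset.piAntidiag Finset.univ N) (fun M N => by simp)
  refine h3.congr_fun fun N => Finset.sum_congr rfl fun M hM => ?_
  have : ∑ e, M e = N := (Finset.mem_piAntidiag.1 hM).1
  rw [this]

theorem fracDeriv_nablaTerm {γ : ℝ} {u : Fin p → Fin n} {v : Fin q → Fin n}
    (hleib : ∀ w z (m : MultiIndex p q), falling α (∑ e, m e) ≠ 0 →
      LeibnizRule a c γ (factor Γ x u v w z m)
        (fracDeriv a (α - ((∑ e, m e : ℕ) : ℝ)) (A w z))) (l : ℕ) :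
    FracDefined a c γ (nablaTerm a Γ x α A u v l) ∧
    ∀ s ∈ interval a c, fracDeriv a γ (nablaTerm a Γ x α A u v l) s =
      ∑ m ∈ Finset.piAntidiag (Finset.univ : Finset (Fin p ⊕ Fin q)) l, ∑ w, ∑ z,
        coef α m * fracDeriv a γ (fun t => (∏ e, factor Γ x u v w z m e t) *
          fracDeriv a (α - ((∑ e, m e : ℕ) : ℝ)) (A w z) t) s := by
  have h := fracDeriv_sum (a := a) (c := c) (γ := γ)
    (Finset.piAntidiag (Finset.univ : Finset (Fin p ⊕ Fin q)) l ×ˢ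
      (Finset.univ : Finset ((Fin p → Fin n) × (Fin q → Fin n))))
    (b := fun y => coef α y.1)
    (f := fun y t => (∏ e, factor Γ x u v y.2.1 y.2.2 y.1 e t) *
      fracDeriv a (α - ((∑ e, y.1 e : ℕ) : ℝ)) (A y.2.1 y.2.2) t)
    (fun y _ hy => (hleib _ _ _ (coef_ne_zero hy)).1)
  have e : (fun t => ∑ y ∈ Finset.piAntidiag (Finset.univ : Finset (Fin p ⊕ Fin q)) l ×ˢ
      (Finset.univ : Finset ((Fin p → Fin n) × (Fin q → Fin n))), coef α y.1 *
        ((∏ e, factor Γ x u v y.2.1 y.2.2 y.1 e t) *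
          fracDeriv a (α - ((∑ e, y.1 e : ℕ) : ℝ)) (A y.2.1 y.2.2) t)) =
      nablaTerm a Γ x α A u v l := by
    funext t
    simp only [Finset.sum_product, Fintype.sum_prod_type, nablaTerm]
    refine Finset.sum_congr rfl fun m hm => Finset.sum_congr rfl fun w _ =>
      Finset.sum_congr rfl fun z _ => ?_
    rw [(Finset.mem_piAntidiag.1 hm).1]
    ring
  rw [e] at h
  refine ⟨h.1, fun s hs => ?_⟩
  rw [h.2 s hs]
  simp only [Finset.sum_product, Fintype.sum_prod_type]

theorem fracDeriv_nabla {l : ℕ} (hl : falling β l ≠ 0) {u : Fin p → Fin n} {v : Fin q → Fin n}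
    (hG : ∀ k, FracDefined a c (β - l) (nablaTerm a Γ x α A u v k))
    (hconv : ∀ s ∈ interval a c, Summable fun k => nablaTerm a Γ x α A u v k s)
    (hconvD : ∀ l : ℕ, falling β l ≠ 0 →
      FracSummable a c (β - l) (nablaTerm a Γ x α A u v)) :
    FracDefined a c (β - l) (nabla a Γ x α A u v) ∧
    ∀ s ∈ interval a c, HasSum (fun k => fracDeriv a (β - l) (nablaTerm a Γ x α A u v k) s)
      (fracDeriv a (β - l) (nabla a Γ x α A u v) s) := by
  refine fracDeriv_tsum hG hconv fun i hi => ?_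
  have := hconvD (l + i) (by
    rw [falling_add]; exact mul_ne_zero hl (falling_ne_zero_of_le_ceil hi))
  rwa [Nat.cast_add, ← sub_sub] at this

/-- For fixed k, summing over r undoes the Leibniz expansion and summing over m undoes the termwise
differentiation of ∇^α A. -/
theorem hasSum_doubleTerm_fiber
    (hleib : ∀ (u w : Fin p → Fin n) (v z : Fin q → Fin n) (m : MultiIndex p q) (l : ℕ),
      falling α (∑ e, m e) ≠ 0 → falling β l ≠ 0 →
        LeibnizRule a c (β - l) (factor Γ x u v w z m)
          (fracDeriv a (α - ((∑ e, m e : ℕ) : ℝ)) (A w z)))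
    (hconv : ∀ u v, ∀ s ∈ interval a c, Summable fun k => nablaTerm a Γ x α A u v k s)
    (hconvD : ∀ u v (l : ℕ), falling β l ≠ 0 →
      FracSummable a c (β - l) (nablaTerm a Γ x α A u v))
    {s : ℝ} (hs : s ∈ interval a c) (j u : Fin p → Fin n) (i v : Fin q → Fin n)
    (k : MultiIndex p q)
    (hsum : ∀ w z, Summable fun K : MultiIndex p q × MultiIndex p q =>
        doubleTerm a Γ x α β A j i u v w z s k K.1 K.2) :
    HasSum (fun K : MultiIndex p q × MultiIndex p q => ∑ w, ∑ z,
        doubleTerm a Γ x α β A j i u v w z s k K.1 K.2)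
      ((∏ e, factor Γ x j i u v k e s) *
        fracDeriv a (β - ((∑ e, k e : ℕ) : ℝ)) (nabla a Γ x α A u v) s * coef β k) := by
  by_cases hk : coef β k = 0
  · simp [doubleTerm, hk]
  have hk := coef_ne_zero hk
  have hG := fracDeriv_nablaTerm (fun w z m hm => hleib u w v z m _ hm hk)
  have hN := (fracDeriv_nabla hk (fun l => (hG l).1) (hconv u v) (hconvD u v)).2 s hs
  have h0 : Summable fun K : MultiIndex p q × MultiIndex p q => ∑ w, ∑ z,
      doubleTerm a Γ x α β A j i u v w z s k K.1 K.2 :=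
    summable_sum fun w _ => summable_sum fun z _ => hsum w z
  have h1 : ∀ m : MultiIndex p q, HasSum (fun r => ∑ w, ∑ z,
      doubleTerm a Γ x α β A j i u v w z s k m r)
      (∑ w, ∑ z, (∏ e, factor Γ x j i u v k e s) * coef β k *
        (coef α m * fracDeriv a (β - ((∑ e, k e : ℕ) : ℝ))
          (fun t => (∏ e, factor Γ x u v w z m e t) *
            fracDeriv a (α - ((∑ e, m e : ℕ) : ℝ)) (A w z) t) s)) := by
    refine fun m => hasSum_sum fun w _ => hasSum_sum fun z _ => ?_
    by_cases hm : coef α m = 0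
    · simp only [hm, zero_mul, mul_zero]
      exact hasSum_zero.congr_fun fun r => by simp [doubleTerm, hm]
    · have := ((hleib u w v z m _ (coef_ne_zero hm) hk).2 s hs).mul_left
        ((∏ e, factor Γ x j i u v k e s) * coef β k * coef α m)
      rw [mul_assoc _ (coef α m)] at this
      exact this.congr_fun fun r => by rw [doubleTerm]; ring
  have h2 := hasSum_fiber (h0.hasSum.prod_fiberwise h1) (fun m => ∑ e, m e)
    (fun N => Finset.piAntidiag Finset.univ N) (fun M N => by simp)
  have h3 := hN.mul_left ((∏ e, factor Γ x j i u v k e s) * coef β k)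
  -- Grouped by |m|, the double series has the same terms as the differentiated series of ∇^α A, so
  -- uniqueness of sums identifies its value.
  have h4 := h2.unique (h3.congr_fun fun l => by
    rw [(hG l).2 s hs]; simp only [Finset.mul_sum])
  rw [mul_right_comm, ← h4]
  exact h0.hasSum

theorem hasSum_nablaTerm_nabla
    (hleib : ∀ (u w : Fin p → Fin n) (v z : Fin q → Fin n) (m : MultiIndex p q) (l : ℕ),
      falling α (∑ e, m e) ≠ 0 → falling β l ≠ 0 →
        LeibnizRule a c (β - l) (factor Γ x u v w z m)
          (fracDeriv a (α - ((∑ e, m e : ℕ) : ℝ)) (A w z)))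
    (hconv : ∀ u v, ∀ s ∈ interval a c, Summable fun k => nablaTerm a Γ x α A u v k s)
    (hconvD : ∀ u v (l : ℕ), falling β l ≠ 0 →
      FracSummable a c (β - l) (nablaTerm a Γ x α A u v))
    {s : ℝ} (hs : s ∈ interval a c) (j : Fin p → Fin n) (i : Fin q → Fin n)
    (hsum : ∀ u v w z, Summable fun K : MultiIndex p q × MultiIndex p q × MultiIndex p q =>
        doubleTerm a Γ x α β A j i u v w z s K.1 K.2.1 K.2.2) :
    HasSum (fun k => nablaTerm a Γ x β (nabla a Γ x α A) j i k s)
      (∑ u, ∑ v, ∑ w, ∑ z, ∑' K : MultiIndex p q × MultiIndex p q × MultiIndex p q,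
        doubleTerm a Γ x α β A j i u v w z s K.1 K.2.1 K.2.2) := by
  have key : ∀ u v, HasSum (fun k : MultiIndex p q => (∏ e, factor Γ x j i u v k e s) *
      fracDeriv a (β - ((∑ e, k e : ℕ) : ℝ)) (nabla a Γ x α A u v) s * coef β k)
      (∑ w, ∑ z, ∑' K : MultiIndex p q × MultiIndex p q × MultiIndex p q,
        doubleTerm a Γ x α β A j i u v w z s K.1 K.2.1 K.2.2) := fun u v =>
    (hasSum_sum (s := Finset.univ) fun w _ =>
      hasSum_sum (s := Finset.univ) fun z _ => (hsum u v w z).hasSum).prod_fiberwise fun k =>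
      hasSum_doubleTerm_fiber hleib hconv hconvD hs j u i v k fun w z =>
        (hsum u v w z).prod_factor k
  have h := hasSum_fiber (hasSum_sum (s := Finset.univ) fun u _ =>
      hasSum_sum (s := Finset.univ) fun v _ => key u v)
    (fun M => ∑ e, M e) (fun N => Finset.piAntidiag Finset.univ N) (fun M N => by simp)
  refine h.congr_fun fun N => Finset.sum_congr rfl fun M hM => ?_
  have : ∑ e, M e = N := (Finset.mem_piAntidiag.1 hM).1
  rw [this]

end

end FracCov

end

theorem mainTheorem2 {n p q : ℕ} (a c : EReal)
    (V : Set (Fin n → ℝ)) (hV : IsOpen V)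
    (Γ : (Fin n → ℝ) → Fin n → Fin n → Fin n → ℝ)
    (hΓ : ∀ i j l, ContDiffOn ℝ ∞ (fun y => Γ y i j l) V)
    (x : ℝ → Fin n → ℝ) (hx : ContDiffOn ℝ ∞ x (FracCov.interval a c))
    (hxV : ∀ s ∈ FracCov.interval a c, x s ∈ V)
    (α β : ℝ) (A : FracCov.TensorAlong n p q)
    -- the semigroup rule for the ordinary fractional derivatives that occur
    (hsemi : ∀ (w : Fin p → Fin n) (z : Fin q → Fin n) (k l : ℕ),
      FracCov.falling α k ≠ 0 → FracCov.falling β l ≠ 0 →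
        FracCov.SemigroupRule a c (β - l) (α - k) (A w z))
    -- the generalized Leibniz rule for the products that occur
    (hleib : ∀ (u w : Fin p → Fin n) (v z : Fin q → Fin n) (m : FracCov.MultiIndex p q) (l : ℕ),
      FracCov.falling α (∑ e, m e) ≠ 0 → FracCov.falling β l ≠ 0 →
        FracCov.LeibnizRule a c (β - l) (FracCov.factor Γ x u v w z m)
          (FracCov.fracDeriv a (α - ((∑ e, m e : ℕ) : ℝ)) (A w z)))
    -- convergence of the series of `∇^α A`, also after ordinary fractional differentiation
    (hconv : ∀ u v, ∀ s ∈ FracCov.interval a c,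
      Summable fun k => FracCov.nablaTerm a Γ x α A u v k s)
    (hconvD : ∀ u v (l : ℕ), FracCov.falling β l ≠ 0 →
      FracCov.FracSummable a c (β - l) (FracCov.nablaTerm a Γ x α A u v))
    -- absolute convergence of the multiple series for `∇^β (∇^α A)`
    (hconv2 : ∀ j i u v w z, ∀ s ∈ FracCov.interval a c,
      Summable fun K : FracCov.MultiIndex p q × FracCov.MultiIndex p q × FracCov.MultiIndex p q =>
        FracCov.doubleTerm a Γ x α β A j i u v w z s K.1 K.2.1 K.2.2) :
    (∀ u v (l : ℕ), FracCov.falling β l ≠ 0 →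
      FracCov.FracDefined a c (β - l) (FracCov.nabla a Γ x α A u v)) ∧
    ∀ j i, ∀ s ∈ FracCov.interval a c,
      (Summable fun k => FracCov.nablaTerm a Γ x β (FracCov.nabla a Γ x α A) j i k s) ∧
      (Summable fun k => FracCov.nablaTerm a Γ x (α + β) A j i k s) ∧
      FracCov.nabla a Γ x β (FracCov.nabla a Γ x α A) j i s =
        FracCov.nabla a Γ x (α + β) A j i s := by
  have hC := FracCov.contDiffOn_conn hΓ hx hxV
  refine ⟨fun u v l hl => (FracCov.fracDeriv_nabla hl
    (fun k => (FracCov.fracDeriv_nablaTerm (fun w z m hm => hleib u w v z m l hm hl) k).1)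
    (hconv u v) (hconvD u v)).1, fun j i s hs => ?_⟩
  have h1 := FracCov.hasSum_nablaTerm_nabla hleib hconv hconvD hs j i
    fun u v w z => hconv2 j i u v w z s hs
  have h2 := FracCov.hasSum_nablaTerm_add hC hsemi hs j i fun u v w z => hconv2 j i u v w z s hs
  refine ⟨h1.summable, h2.summable, h1.tsum_eq.trans (Eq.trans ?_ h2.tsum_eq.symm)⟩
  -- The two values differ only in the order of the finite sums over (u, v) and (w, z).
  simp only [← Fintype.sum_prod_type']
  exact Fintype.sum_equiv ((Equiv.prodAssoc _ _ _).symm.trans ((Equiv.prodComm _ _).trans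
    (Equiv.prodAssoc _ _ _))) _ _ fun _ => rfl
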